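/- Let $\Sigma$ be a finite nonempty alphabet. An alternating automaton is $\mathcal A=(\Sigma,Q,\iota,\delta,\alpha)$ with a finite set $Q$ of states, $\iota\in Q$, $\delta:Q\times\Sigma\to B^+(Q)$, where $B^+(Q)$ is the set of positive boolean formulas built from the elements of $Q$ with $\wedge$ and $\vee$, and $\alpha\subseteq Q$. It is deterministic if all values of $\delta$ are states. In the model-checking game of $\mathcal A$ on a word $w$, a play starts in the state $\iota$; from a state $q$ the next letter $a$ of $w$ is read and the play moves to $\delta(q,a)$; from $b\wedge b'$ Adam, and from $b\vee b'$ Eve, chooses one of $b,b'$ to continue with. If $w$ is finite, Eve wins when the state reached after reading all of $w$ is in $\alpha$; if $w$ is infinite, Eve wins when the play visits $\alpha$ infinitely often (Büchi condition). The language $L(\mathcal A)$ is the set of (finite, respectively infinite) words on which Eve has a winning strategy; two automata are equivalent if they have the same language. An automaton on finite words is called an AFA (a DFA if it is deterministic). An automaton on infinite words is called an AWW (a DWW if it is deterministic) if it is weak: in the graph on $Q$ with an edge $q\to q'$ whenever $q'$ occurs in $\delta(q,a)$ for some $a\in\Sigma$, every strongly connected component is contained in $\alpha$ or disjoint from $\alpha$.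 $\mathcal A$ is good for games (GFG), in the form of history-determinism, if there are functions $\tau_E,\tau_A:(\Sigma\times B^+(Q))^*\to B^+(Q)$, which see only the letters read so far and the transition conditions visited so far, such that $\tau_E$ is a winning strategy for Eve in the model-checking game on every $w\in L(\mathcal A)$, and $\tau_A$ is a winning strategy for Adam in the model-checking game on every $w\notin L(\mathcal A)$. **Theorem.** For every GFG AFA $\mathcal A$ there is an equivalent DFA, and for every GFG AWW $\mathcal A$ there is an equivalent DWW, whose number of states is not more than that of $\mathcal A$. -/

import Mathlib

/-- Positive boolean formulas (transition conditions) over a set `Q` of states. -/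
inductive PosForm (Q : Type*) where
  | state (q : Q) : PosForm Q
  | conj (b c : PosForm Q) : PosForm Q
  | disj (b c : PosForm Q) : PosForm Q

namespace PosForm

/-- The states that occur in a transition condition. -/
def states {Q : Type*} : PosForm Q → Set Q
  | state q => {q}
  | conj b c => b.states ∪ c.states
  | disj b c => b.states ∪ c.states

end PosForm

/-! ### Two-player games -/

inductive Player where
  | eve
  | adam

/-- A rooted two-player game of infinite duration; `eveWins` is the set of plays won by Eve,
all other plays are won by Adam. -/
structure Game (V : Type*) where
  init : V
  owner : V → Player
  Move : V → V → Prop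
  eveWins : Set (ℕ → V)

namespace Game

variable {V : Type*} (G : Game V)

/-- A play is an infinite path from the root. -/
def IsPlay (π : ℕ → V) : Prop :=
  π 0 = G.init ∧ ∀ k, G.Move (π k) (π (k + 1))

/-- The positions of a play strictly before time `k`. -/
def past (π : ℕ → V) (k : ℕ) : List V :=
  (List.range k).map π

/-- The play is won by the given player. -/
def WonBy : Player → (ℕ → V) → Prop
  | .eve, π => π ∈ G.eveWins
  | .adam, π => π ∉ G.eveWins

/-- `s` is a strategy for `p`: given a history of a play, split into the past and the current
position, it picks a legal move whenever the current position belongs to `p`. -/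
def IsStrategy (p : Player) (s : List V → V → V) : Prop :=
  ∀ π, G.IsPlay π → ∀ k, G.owner (π k) = p → G.Move (π k) (s (past π k) (π k))

/-- The play `π` agrees with the strategy `s` of the player `p`. -/
def Agrees (p : Player) (s : List V → V → V) (π : ℕ → V) : Prop :=
  ∀ k, G.owner (π k) = p → π (k + 1) = s (past π k) (π k)

/-- `s` is a winning strategy (from the root) for the player `p`. -/
def IsWinning (p : Player) (s : List V → V → V) : Prop :=
  G.IsStrategy p s ∧ ∀ π, G.IsPlay π → G.Agrees p s π → G.WonBy p π

/-- The player `p` wins the game. -/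
def Wins (p : Player) : Prop :=
  ∃ s, G.IsWinning p s

end Game

/-! ### Alternating automata -/

/-- An alternating automaton over the alphabet `α` with states `Q`, whose acceptance condition is
a set of states: the final states on finite words, the Büchi accepting states on infinite words. -/
structure AltAutomaton (α Q : Type*) where
  init : Q
  δ : Q → α → PosForm Q
  acc : Set Q

namespace AltAutomaton

variable {α Q : Type*} (A : AltAutomaton α Q)

/-- All transition conditions are states. -/
def IsDeterministic : Prop :=
  ∀ q a, ∃ q', A.δ q a = PosForm.state q'

/-- The graph on the states that is induced by the transition function. -/
def Edge (q q' : Q) : Prop :=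
  ∃ a, q' ∈ (A.δ q a).states

/-- Weakness: every strongly connected component consists only of accepting or only of rejecting
states. -/
def IsWeak : Prop :=
  ∀ q q', Relation.ReflTransGen A.Edge q q' → Relation.ReflTransGen A.Edge q' q →
    (q ∈ A.acc ↔ q' ∈ A.acc)

/-! #### The model-checking game

A finite or infinite word is given by its letters `ℓ : ℕ → Option α`, with `ℓ i = none` beyond the
end of a finite word. A position `(i, b)` of the game means that `i` letters have been read and
that `b` is the current transition condition. A play starts in `(0, init)`. -/

/-- The position after `(i, q)`: the next letter is read; if there is none, the play stays put. -/
def next (ℓ : ℕ → Option α) (i : ℕ) (q : Q) : ℕ × PosForm Q :=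
  match ℓ i with
  | some a => (i + 1, A.δ q a)
  | none => (i, PosForm.state q)

/-- Moves of the model-checking game. -/
def MCMove (ℓ : ℕ → Option α) : ℕ × PosForm Q → ℕ × PosForm Q → Prop
  | (i, .state q), v => v = A.next ℓ i q
  | (i, .conj b c), v => v = (i, b) ∨ v = (i, c)
  | (i, .disj b c), v => v = (i, b) ∨ v = (i, c)

/-- Adam resolves conjunctions and Eve resolves disjunctions. Positions whose condition is a state
have exactly one successor; they are given to Eve, which does not matter. -/
def mcOwner : ℕ × PosForm Q → Player
  | (_, .state _) => .eve
  | (_, .conj _ _) => .adam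
  | (_, .disj _ _) => .eve

/-- The model-checking game on a word, with the given set of plays won by Eve. -/
def mcGame (ℓ : ℕ → Option α) (W : Set (ℕ → ℕ × PosForm Q)) : Game (ℕ × PosForm Q) where
  init := (0, PosForm.state A.init)
  owner := mcOwner
  Move := A.MCMove ℓ
  eveWins := W

/-- On a finite word, Eve wins if the state reached after reading the whole word is final. -/
def finGame (u : List α) : Game (ℕ × PosForm Q) :=
  A.mcGame (fun i => u[i]?) {π | ∃ k, ∃ q ∈ A.acc, π k = (u.length, PosForm.state q)}

/-- On an infinite word, Eve wins if accepting states are visited infinitely often. -/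
def infGame (w : ℕ → α) : Game (ℕ × PosForm Q) :=
  A.mcGame (fun i => some (w i))
    {π | ∃ᶠ k in Filter.atTop, ∃ i, ∃ q ∈ A.acc, π k = (i, PosForm.state q)}

/-- The language of finite words recognized by `A`. -/
def finLanguage : Language α :=
  {u : List α | (A.finGame u).Wins .eve}

/-- The language of infinite words recognized by `A`. -/
def infLanguage : Set (ℕ → α) :=
  {w | (A.infGame w).Wins .eve}

/-! #### Good-for-games automata (history-determinism) -/

/-- A position of the model-checking game as it is seen by a history-deterministic strategy: the
last letter read and the transition condition. The initial position, before the first letter, is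
not recorded. -/
def observe (ℓ : ℕ → Option α) : ℕ × PosForm Q → Option (α × PosForm Q)
  | (0, _) => none
  | (i + 1, b) => (ℓ i).map fun a => (a, b)

/-- The use of a function `τ : (α × B⁺(Q))* → B⁺(Q)`, which sees only the letters read so far and
the transition conditions visited so far, as a strategy in the model-checking game on a word. If
the current condition is a state, the unique move is made. -/
def extend (ℓ : ℕ → Option α) (τ : List (α × PosForm Q) → PosForm Q)
    (h : List (ℕ × PosForm Q)) : ℕ × PosForm Q → ℕ × PosForm Q
  | (i, .state q) => A.next ℓ i q
  | (i, .conj b c) => (i, τ ((h ++ [(i, PosForm.conj b c)]).filterMap (observe ℓ)))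
  | (i, .disj b c) => (i, τ ((h ++ [(i, PosForm.disj b c)]).filterMap (observe ℓ)))

/-- `A` is good for games as an automaton on finite words: both its nondeterminism and its
universality are history-deterministic. -/
def FinGFG : Prop :=
  (∃ τ : List (α × PosForm Q) → PosForm Q, ∀ u : List α, u ∈ A.finLanguage →
    (A.finGame u).IsWinning .eve (A.extend (fun i => u[i]?) τ)) ∧
  (∃ τ : List (α × PosForm Q) → PosForm Q, ∀ u : List α, u ∉ A.finLanguage →
    (A.finGame u).IsWinning .adam (A.extend (fun i => u[i]?) τ))

/-- `A` is good for games as a Büchi automaton on infinite words: both its nondeterminism and its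
universality are history-deterministic. -/
def InfGFG : Prop :=
  (∃ τ : List (α × PosForm Q) → PosForm Q, ∀ w : ℕ → α, w ∈ A.infLanguage →
    (A.infGame w).IsWinning .eve (A.extend (fun i => some (w i)) τ)) ∧
  (∃ τ : List (α × PosForm Q) → PosForm Q, ∀ w : ℕ → α, w ∉ A.infLanguage →
    (A.infGame w).IsWinning .adam (A.extend (fun i => some (w i)) τ))

end AltAutomaton

/-! ### Relation sequences -/

/-! Let the two history-deterministic strategies play against each other: this joint run (`mainRun`)
sends every finite word u to a state q(u). If q(u) = q(u'), then u and u' have the same residual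
language. Otherwise, up to symmetry, some continuation v has uv accepted and u'v rejected. Continue
from the common state on v, with Eve remembering the history of u and Adam that of u'. The result
completes a play on uv that follows Eve's winning strategy and also a play on u'v that follows
Adam's, so it would be both accepting and rejecting. This is the core of both `exists_classifier`
lemmas. Hence there are at most |Q| residuals, and their quotient (`exists_quotient_transition`)
carries the deterministic automaton.

On infinite words, a component of the quotient is made accepting if some accepted word stays in it
forever. This is correct because no rejected word can then stay there too
(`IsWeak.not_recurrent_and_recurrent`): alternating between two such words, long enough for q to
meet an accepting and a rejecting state in each round, closes by pigeonhole a cycle of A through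
states of both kinds, against weakness. -/

theorem exists_nat_path_of_transGen {X : Type*} {R : X → X → Prop} {a b : X}
    (h : Relation.TransGen R a b) :
    ∃ (m : ℕ) (g : ℕ → X), g 0 = a ∧ g (m + 1) = b ∧ ∀ k ≤ m, R (g k) (g (k + 1)) := by
  induction h using Relation.TransGen.head_induction_on with
  | @single a hab =>
    refine ⟨0, fun k => if k = 0 then a else b, by simp, by simp, ?_⟩
    intro k hk
    obtain rfl : k = 0 := by omega
    simpa using hab
  | @head a c hac _ ih =>
    obtain ⟨m, g, h0, hm, hg⟩ := ih
    refine ⟨m + 1, fun k => Nat.casesOn k a g, rfl, hm, ?_⟩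
    rintro (_ | k) hk
    · simpa [h0] using hac
    · exact hg k (by omega)

/-- An infinite chain of nonempty finite paths can be concatenated. -/
theorem exists_seq_of_forall_transGen {X : Type*} {R : X → X → Prop} {c : ℕ → X}
    (h : ∀ n, Relation.TransGen R (c n) (c (n + 1))) :
    ∃ (f : ℕ → X) (T : ℕ → ℕ), StrictMono T ∧ (∀ n, f (T n) = c n) ∧ f 0 = c 0 ∧
      ∀ k, R (f k) (f (k + 1)) := by
  choose m g h0 hm hg using fun n => exists_nat_path_of_transGen (h n)
  -- A pair is a block number and an offset in that block; the end of a block is identified with the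
  -- start of the next.
  let F : ℕ × ℕ → ℕ × ℕ := fun p => if p.2 < m p.1 then (p.1, p.2 + 1) else (p.1 + 1, 0)
  have hle : ∀ k, (F^[k] (0, 0)).2 ≤ m (F^[k] (0, 0)).1 := by
    intro k
    induction k with
    | zero => simp
    | succ k ih =>
      rw [Function.iterate_succ_apply']
      simp only [F]
      split
      · simp; omega
      · simp
  have hin : ∀ n j, j ≤ m n → F^[j] (n, 0) = (n, j) := by
    intro n j
    induction j with
    | zero => simp
    | succ j ih =>
      intro hj
      rw [Function.iterate_succ_apply', ih (by omega)]
      simp only [F]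
      rw [if_pos (by omega)]
  have hblock : ∀ n, F^[m n + 1] (n, 0) = (n + 1, 0) := by
    intro n
    rw [Function.iterate_succ_apply', hin n _ le_rfl]
    simp [F]
  let T : ℕ → ℕ := fun n => ∑ i ∈ Finset.range n, (m i + 1)
  have hT : ∀ n, F^[T n] (0, 0) = (n, 0) := by
    intro n
    induction n with
    | zero => simp [T]
    | succ n ih =>
      have : T (n + 1) = (m n + 1) + T n := by simp [T, Finset.sum_range_succ]; omega
      rw [this, Function.iterate_add_apply, ih, hblock]
  refine ⟨fun k => g (F^[k] (0, 0)).1 (F^[k] (0, 0)).2, T, ?_, ?_, ?_, ?_⟩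
  · apply strictMono_nat_of_lt_succ
    intro n
    simp [T, Finset.sum_range_succ]
  · intro n
    simp [hT, h0]
  · simp [h0]
  · intro k
    have hk := hle k
    simp only [Function.iterate_succ_apply']
    generalize F^[k] (0, 0) = p at hk
    have := hg p.1 p.2 hk
    by_cases hp : p.2 < m p.1
    · simpa [F, hp] using this
    · have hpm : p.2 = m p.1 := by omega
      simp only [F, hp, if_false, h0]
      rw [hpm] at this ⊢
      rwa [hm] at this

theorem exists_seq_of_reflTransGen {X : Type*} {R : X → X → Prop} {a b : X}
    (h : Relation.ReflTransGen R a b) {f : ℕ → X} (hf0 : f 0 = b)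
    (hf : ∀ k, R (f k) (f (k + 1))) :
    ∃ (g : ℕ → X) (t : ℕ), g 0 = a ∧ (∀ k, R (g k) (g (k + 1))) ∧ ∀ k, g (t + k) = f k := by
  induction h using Relation.ReflTransGen.head_induction_on with
  | refl => exact ⟨f, 0, hf0, hf, by simp⟩
  | @head a c hac _ ih =>
    obtain ⟨g, t, h0, hg, hgf⟩ := ih
    refine ⟨fun k => Nat.casesOn k a g, t + 1, rfl, ?_, ?_⟩
    · rintro (_ | k)
      · simpa [h0] using hac
      · exact hg k
    · intro k
      rw [show t + 1 + k = (t + k) + 1 by omega]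
      exact hgf k

/-- If every point reachable from `a` has a successor, then every path from `a` to `b` is the
beginning of an infinite path. -/
theorem exists_seq_through {X : Type*} {R : X → X → Prop} {a b : X}
    (hR : ∀ x, Relation.ReflTransGen R a x → ∃ y, R x y) (h : Relation.ReflTransGen R a b) :
    ∃ (g : ℕ → X) (t : ℕ), g 0 = a ∧ (∀ k, R (g k) (g (k + 1))) ∧ g t = b := by
  choose! s hs using hR
  have hreach : ∀ k, Relation.ReflTransGen R a (s^[k] b) := by
    intro k
    induction k with
    | zero => exact h
    | succ k ih =>
      rw [Function.iterate_succ_apply']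
      exact ih.tail (hs _ ih)
  obtain ⟨g, t, h0, hg, hgf⟩ := exists_seq_of_reflTransGen h (f := fun k => s^[k] b) rfl
    (fun k => by
      rw [Function.iterate_succ_apply']
      exact hs _ (hreach k))
  exact ⟨g, t, h0, hg, by simpa using hgf 0⟩

theorem Game.past_succ {V : Type*} (π : ℕ → V) (k : ℕ) :
    Game.past π (k + 1) = Game.past π k ++ [π k] := by
  simp [Game.past, List.range_succ]

namespace AltAutomaton

variable {α Q : Type*} (A : AltAutomaton α Q)

/-! ### Partial plays of the model-checking game -/

/-- Extension of a partial play, given by its past and its current position, by one move. -/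
def LegalStep (ℓ : ℕ → Option α) (x y : List (ℕ × PosForm Q) × (ℕ × PosForm Q)) : Prop :=
  y.1 = x.1 ++ [x.2] ∧ A.MCMove ℓ x.2 y.2

/-- Extension of a partial play by one move that agrees with the function `τ` for the player `p`. -/
def StepBy (p : Player) (τ : List (α × PosForm Q) → PosForm Q) (ℓ : ℕ → Option α)
    (x y : List (ℕ × PosForm Q) × (ℕ × PosForm Q)) : Prop :=
  A.LegalStep ℓ x y ∧ (mcOwner x.2 = p → y.2 = A.extend ℓ τ x.1 x.2)

/-- The partial play that consists of the root only. -/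
def rootPlay : List (ℕ × PosForm Q) × (ℕ × PosForm Q) :=
  ([], (0, PosForm.state A.init))

variable {A}

/-- Partial plays carry their past, so that following a history-dependent strategy becomes a binary
relation, to which reflexive-transitive closures apply. -/
theorem past_of_legalStep {ℓ : ℕ → Option α}
    {f : ℕ → List (ℕ × PosForm Q) × (ℕ × PosForm Q)} (h0 : f 0 = A.rootPlay)
    (hf : ∀ k, A.LegalStep ℓ (f k) (f (k + 1))) (k : ℕ) :
    (f k).1 = Game.past (fun n => (f n).2) k := by
  induction k with
  | zero => simp [h0, rootPlay, Game.past]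
  | succ k ih => rw [(hf k).1, Game.past_succ, ih]

theorem isPlay_of_legalStep {ℓ : ℕ → Option α} (W : Set (ℕ → ℕ × PosForm Q))
    {f : ℕ → List (ℕ × PosForm Q) × (ℕ × PosForm Q)} (h0 : f 0 = A.rootPlay)
    (hf : ∀ k, A.LegalStep ℓ (f k) (f (k + 1))) :
    (A.mcGame ℓ W).IsPlay (fun n => (f n).2) :=
  ⟨by simp [h0, rootPlay, mcGame], fun k => (hf k).2⟩

theorem agrees_of_stepBy {ℓ : ℕ → Option α} (W : Set (ℕ → ℕ × PosForm Q)) {p : Player}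
    {τ : List (α × PosForm Q) → PosForm Q}
    {f : ℕ → List (ℕ × PosForm Q) × (ℕ × PosForm Q)} (h0 : f 0 = A.rootPlay)
    (hf : ∀ k, A.StepBy p τ ℓ (f k) (f (k + 1))) :
    (A.mcGame ℓ W).Agrees p (A.extend ℓ τ) (fun n => (f n).2) := by
  intro k hk
  rw [← past_of_legalStep h0 (fun k => (hf k).1)]
  exact (hf k).2 hk

theorem exists_mcMove (ℓ : ℕ → Option α) (v : ℕ × PosForm Q) : ∃ v', A.MCMove ℓ v v' := by
  obtain ⟨i, _ | _ | _⟩ := v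
  · exact ⟨_, rfl⟩
  · exact ⟨_, Or.inl rfl⟩
  · exact ⟨_, Or.inl rfl⟩

/-- `IsStrategy` speaks of infinite plays only, so the partial play is first prolonged by arbitrary
legal moves; there are no dead ends. -/
theorem extend_legal {ℓ : ℕ → Option α} {W : Set (ℕ → ℕ × PosForm Q)} {p : Player}
    {τ : List (α × PosForm Q) → PosForm Q}
    (hτ : (A.mcGame ℓ W).IsStrategy p (A.extend ℓ τ))
    {x : List (ℕ × PosForm Q) × (ℕ × PosForm Q)}
    (hx : Relation.ReflTransGen (A.StepBy p τ ℓ) A.rootPlay x) (hp : mcOwner x.2 = p) :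
    A.MCMove ℓ x.2 (A.extend ℓ τ x.1 x.2) := by
  obtain ⟨g, t, h0, hg, rfl⟩ := exists_seq_through (a := A.rootPlay) (b := x) (R := A.LegalStep ℓ)
    (fun x _ => (exists_mcMove ℓ x.2).elim fun v hv => ⟨(x.1 ++ [x.2], v), rfl, hv⟩)
    (Relation.ReflTransGen.mono (r := A.StepBy p τ ℓ) (fun _ _ h => h.1) _ _ hx)
  rw [past_of_legalStep h0 hg]
  exact hτ _ (isPlay_of_legalStep W h0 hg) t hp

theorem exists_stepBy {ℓ : ℕ → Option α} {W : Set (ℕ → ℕ × PosForm Q)} {p : Player}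
    {τ : List (α × PosForm Q) → PosForm Q}
    (hτ : (A.mcGame ℓ W).IsStrategy p (A.extend ℓ τ))
    (x : List (ℕ × PosForm Q) × (ℕ × PosForm Q))
    (hx : Relation.ReflTransGen (A.StepBy p τ ℓ) A.rootPlay x) :
    ∃ y, A.StepBy p τ ℓ x y := by
  by_cases hp : mcOwner x.2 = p
  · exact ⟨(x.1 ++ [x.2], _), ⟨rfl, extend_legal hτ hx hp⟩, fun _ => rfl⟩
  · obtain ⟨v, hv⟩ := exists_mcMove (A := A) ℓ x.2
    exact ⟨(x.1 ++ [x.2], v), ⟨rfl, hv⟩, fun h => absurd h hp⟩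

/-! ### States visited by a play -/

theorem fst_le_of_mcMove {ℓ : ℕ → Option α} {v v' : ℕ × PosForm Q} (h : A.MCMove ℓ v v') :
    v.1 ≤ v'.1 := by
  obtain ⟨i, q | _ | _⟩ := v
  · obtain rfl : v' = A.next ℓ i q := h
    unfold next
    split <;> simp
  · rcases h with rfl | rfl <;> simp
  · rcases h with rfl | rfl <;> simp

theorem fst_monotone {ℓ : ℕ → Option α} {π : ℕ → ℕ × PosForm Q}
    (h : ∀ k, A.MCMove ℓ (π k) (π (k + 1))) : Monotone fun k => (π k).1 :=
  monotone_nat_of_le_succ fun k => fst_le_of_mcMove (h k)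

/-- At most one state is visited after `i` letters have been read. -/
theorem state_unique {ℓ : ℕ → Option α} {π : ℕ → ℕ × PosForm Q}
    (h : ∀ k, A.MCMove ℓ (π k) (π (k + 1))) {k k' i : ℕ} {q q' : Q}
    (hk : π k = (i, .state q)) (hk' : π k' = (i, .state q')) : q = q' := by
  wlog hkk : k ≤ k' generalizing k k' q q'
  · exact (this hk' hk (by omega)).symm
  cases hℓ : ℓ i with
  | none =>
    -- Beyond the end of a finite word the play is frozen.
    have hconst : ∀ n, π (k + n) = (i, .state q) := by
      intro n
      induction n with
      | zero => exact hk
      | succ n ih =>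
        have := h (k + n)
        rw [ih] at this
        change π (k + (n + 1)) = A.next ℓ i q at this
        rw [this, next, hℓ]
    have := hconst (k' - k)
    rw [Nat.add_sub_cancel' hkk, hk'] at this
    simpa using this.symm
  | some a =>
    rcases hkk.eq_or_lt with rfl | hlt
    · rw [hk] at hk'
      simpa using hk'
    -- Leaving a state reads a letter, so the counter exceeds `i` from time `k + 1` on.
    · have h1 := h k
      rw [hk] at h1
      change π (k + 1) = A.next ℓ i q at h1
      rw [next, hℓ] at h1
      have h2 : (π (k + 1)).1 ≤ (π k').1 := fst_monotone h hlt
      rw [h1, hk'] at h2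
      simp at h2

variable (A)

/-! ### Both strategies played against each other -/

open Classical in
/-- Resolution of a transition condition after the letter `a`, where each player `p` has made the
observations `o p` and plays by `τ p`, as far as this is legal. -/
noncomputable def resolve (τ : Player → List (α × PosForm Q) → PosForm Q) (a : α) :
    PosForm Q → (Player → List (α × PosForm Q)) → (Player → List (α × PosForm Q)) × Q
  | .state q, o => (o, q)
  | .conj b c, o =>
    -- The branch `b` also serves as default for illegal answers: on a given word only one of the
    -- two strategies is known to be legal.
    if τ .adam (o .adam) = c then resolve τ a c (fun p => o p ++ [(a, c)])
    else resolve τ a b (fun p => o p ++ [(a, b)])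
  | .disj b c, o =>
    if τ .eve (o .eve) = c then resolve τ a c (fun p => o p ++ [(a, c)])
    else resolve τ a b (fun p => o p ++ [(a, b)])

/-- The observations and the state after the next letter. -/
noncomputable def stepLetter (τ : Player → List (α × PosForm Q) → PosForm Q)
    (x : (Player → List (α × PosForm Q)) × Q) (a : α) : (Player → List (α × PosForm Q)) × Q :=
  resolve τ a (A.δ x.2 a) fun p => x.1 p ++ [(a, A.δ x.2 a)]

/-- The observations and the state after the letters of a word. -/
noncomputable def run (τ : Player → List (α × PosForm Q) → PosForm Q)
    (x : (Player → List (α × PosForm Q)) × Q) (u : List α) :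
    (Player → List (α × PosForm Q)) × Q :=
  u.foldl (A.stepLetter τ) x

/-- The run from the initial state, without prior observations. -/
noncomputable def mainRun (τ : Player → List (α × PosForm Q) → PosForm Q) (u : List α) :
    (Player → List (α × PosForm Q)) × Q :=
  A.run τ (fun _ => [], A.init) u

variable {A} {τ : Player → List (α × PosForm Q) → PosForm Q}

theorem resolve_mem_states (a : α) (b : PosForm Q) (o : Player → List (α × PosForm Q)) :
    (resolve τ a b o).2 ∈ b.states := by
  induction b generalizing o with
  | state q => simp [resolve, PosForm.states]
  | conj b c hb hc =>
    simp only [resolve, PosForm.states]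
    split
    · exact Or.inr (hc _)
    · exact Or.inl (hb _)
  | disj b c hb hc =>
    simp only [resolve, PosForm.states]
    split
    · exact Or.inr (hc _)
    · exact Or.inl (hb _)

theorem run_append (x : (Player → List (α × PosForm Q)) × Q) (u v : List α) :
    A.run τ x (u ++ v) = A.run τ (A.run τ x u) v :=
  List.foldl_append

theorem run_append_singleton (x : (Player → List (α × PosForm Q)) × Q) (u : List α) (a : α) :
    A.run τ x (u ++ [a]) = A.stepLetter τ (A.run τ x u) a :=
  run_append x u [a]

theorem reach_run (x : (Player → List (α × PosForm Q)) × Q) (u : List α) :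
    Relation.ReflTransGen A.Edge x.2 (A.run τ x u).2 := by
  induction u using List.reverseRecOn with
  | nil => exact .refl
  | append_singleton u a ih =>
    rw [run_append_singleton]
    exact ih.tail ⟨a, resolve_mem_states _ _ _⟩

theorem reach_mainRun (u v : List α) :
    Relation.ReflTransGen A.Edge (A.mainRun τ u).2 (A.mainRun τ (u ++ v)).2 := by
  unfold mainRun
  rw [run_append]
  exact reach_run _ _

/-! ### Transfer of joint runs to plays of the model-checking game -/

variable (A) in
/-- The run configuration `x`, after `i` letters, is realized for the player `p` by the partial play
with past `h` on the word `ℓ`. -/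
def Realizes (τ : Player → List (α × PosForm Q) → PosForm Q) (p : Player) (ℓ : ℕ → Option α)
    (x : (Player → List (α × PosForm Q)) × Q) (i : ℕ) (h : List (ℕ × PosForm Q)) : Prop :=
  Relation.ReflTransGen (A.StepBy p (τ p) ℓ) A.rootPlay (h, (i, .state x.2)) ∧
    x.1 p = (h ++ [(i, PosForm.state x.2)]).filterMap (observe ℓ)

section

variable {p : Player} {ℓ : ℕ → Option α} {W : Set (ℕ → ℕ × PosForm Q)}

/-- Only the strategy of `p` has to be legal on the word; the opponent's choices need only be legal
moves, which `resolve` always makes. -/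
theorem resolve_realizes (hτ : (A.mcGame ℓ W).IsStrategy p (A.extend ℓ (τ p))) {i : ℕ} {a : α}
    (ha : ℓ i = some a) (b : PosForm Q) (o : Player → List (α × PosForm Q))
    (h : List (ℕ × PosForm Q))
    (hr : Relation.ReflTransGen (A.StepBy p (τ p) ℓ) A.rootPlay (h, (i + 1, b)))
    (ho : o p = (h ++ [(i + 1, b)]).filterMap (observe ℓ)) :
    ∃ h', Relation.ReflTransGen (A.StepBy p (τ p) ℓ) (h, (i + 1, b))
        (h', (i + 1, PosForm.state (resolve τ a b o).2)) ∧
      (resolve τ a b o).1 p =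
        (h' ++ [(i + 1, PosForm.state (resolve τ a b o).2)]).filterMap (observe ℓ) := by
  -- One move to `d` followed by the induction hypothesis for `d`, shared by the four cases below.
  have key : ∀ (b d : PosForm Q) (o : Player → List (α × PosForm Q)) (h : List (ℕ × PosForm Q)),
      Relation.ReflTransGen (A.StepBy p (τ p) ℓ) A.rootPlay (h, (i + 1, b)) →
      o p = (h ++ [(i + 1, b)]).filterMap (observe ℓ) →
      A.StepBy p (τ p) ℓ (h, (i + 1, b)) (h ++ [(i + 1, b)], (i + 1, d)) →
      (∀ (o : Player → List (α × PosForm Q)) (h : List (ℕ × PosForm Q)),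
        Relation.ReflTransGen (A.StepBy p (τ p) ℓ) A.rootPlay (h, (i + 1, d)) →
        o p = (h ++ [(i + 1, d)]).filterMap (observe ℓ) →
        ∃ h', Relation.ReflTransGen (A.StepBy p (τ p) ℓ) (h, (i + 1, d))
            (h', (i + 1, PosForm.state (resolve τ a d o).2)) ∧
          (resolve τ a d o).1 p =
            (h' ++ [(i + 1, PosForm.state (resolve τ a d o).2)]).filterMap (observe ℓ)) →
      ∃ h', Relation.ReflTransGen (A.StepBy p (τ p) ℓ) (h, (i + 1, b))
          (h', (i + 1, PosForm.state (resolve τ a d fun p => o p ++ [(a, d)]).2)) ∧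
        (resolve τ a d fun p => o p ++ [(a, d)]).1 p =
          (h' ++ [(i + 1, PosForm.state (resolve τ a d fun p => o p ++ [(a, d)]).2)]).filterMap
            (observe ℓ) := by
    intro b d o h hr ho hs ih
    obtain ⟨h', h1, h2⟩ := ih (fun p => o p ++ [(a, d)]) _ (hr.tail hs)
      (by
        rw [List.filterMap_append, ← ho]
        simp [observe, ha])
    exact ⟨h', h1.head hs, h2⟩
  induction b generalizing o h with
  | state q => exact ⟨h, .refl, ho⟩
  | conj b c hb hc =>
    -- By legality, the default branch `b` is taken only if it is the strategy's answer.
    have hleg : p = .adam → τ .adam (o .adam) = b ∨ τ .adam (o .adam) = c := by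
      rintro rfl
      have := extend_legal hτ hr rfl
      simpa [extend, MCMove, ho] using this
    simp only [resolve]
    split
    · rename_i heq
      refine key _ c o h hr ho ⟨⟨rfl, Or.inr rfl⟩, ?_⟩ hc
      intro hp
      obtain rfl := hp.symm
      simp only [extend]
      rw [← ho]
      exact congrArg _ heq.symm
    · rename_i hne
      refine key _ b o h hr ho ⟨⟨rfl, Or.inl rfl⟩, ?_⟩ hb
      intro hp
      obtain rfl := hp.symm
      simp only [extend]
      rw [← ho]
      exact congrArg _ ((hleg rfl).resolve_right hne).symm
  | disj b c hb hc =>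
    have hleg : p = .eve → τ .eve (o .eve) = b ∨ τ .eve (o .eve) = c := by
      rintro rfl
      have := extend_legal hτ hr rfl
      simpa [extend, MCMove, ho] using this
    simp only [resolve]
    split
    · rename_i heq
      refine key _ c o h hr ho ⟨⟨rfl, Or.inr rfl⟩, ?_⟩ hc
      intro hp
      obtain rfl := hp.symm
      simp only [extend]
      rw [← ho]
      exact congrArg _ heq.symm
    · rename_i hne
      refine key _ b o h hr ho ⟨⟨rfl, Or.inl rfl⟩, ?_⟩ hb
      intro hp
      obtain rfl := hp.symm
      simp only [extend]
      rw [← ho]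
      exact congrArg _ ((hleg rfl).resolve_right hne).symm

/-- Reading a letter takes at least one move; `TransGen` records this for the later concatenation
into an infinite play. -/
theorem Realizes.stepLetter (hτ : (A.mcGame ℓ W).IsStrategy p (A.extend ℓ (τ p)))
    {x : (Player → List (α × PosForm Q)) × Q} {i : ℕ} {h : List (ℕ × PosForm Q)} {a : α}
    (hx : A.Realizes τ p ℓ x i h) (ha : ℓ i = some a) :
    ∃ h', Relation.TransGen (A.StepBy p (τ p) ℓ) (h, (i, .state x.2))
        (h', (i + 1, .state (A.stepLetter τ x a).2)) ∧
      A.Realizes τ p ℓ (A.stepLetter τ x a) (i + 1) h' := by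
  have hs : A.StepBy p (τ p) ℓ (h, (i, .state x.2))
      (h ++ [(i, PosForm.state x.2)], (i + 1, A.δ x.2 a)) := by
    have : A.next ℓ i x.2 = (i + 1, A.δ x.2 a) := by simp [next, ha]
    exact ⟨⟨rfl, this.symm⟩, fun _ => this.symm⟩
  obtain ⟨h', h1, h2⟩ := resolve_realizes hτ ha (A.δ x.2 a)
    (fun p => x.1 p ++ [(a, A.δ x.2 a)]) _ (hx.1.tail hs)
    (by
      rw [List.filterMap_append, ← hx.2]
      simp [observe, ha])
  exact ⟨h', Relation.TransGen.head' hs h1, (hx.1.tail hs).trans h1, h2⟩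

theorem Realizes.run (hτ : (A.mcGame ℓ W).IsStrategy p (A.extend ℓ (τ p)))
    {x : (Player → List (α × PosForm Q)) × Q} {i : ℕ} {h : List (ℕ × PosForm Q)} (u : List α)
    (hx : A.Realizes τ p ℓ x i h) (hu : ∀ k < u.length, ℓ (i + k) = u[k]?) :
    ∃ h', A.Realizes τ p ℓ (A.run τ x u) (i + u.length) h' := by
  induction u generalizing x i h with
  | nil => exact ⟨h, hx⟩
  | cons a u ih =>
    obtain ⟨h', -, h2⟩ := hx.stepLetter hτ (hu 0 (by simp))
    have := ih h2 (fun k hk => by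
      have := hu (k + 1) (by simpa using hk)
      rwa [← add_assoc, add_right_comm] at this)
    rwa [List.length_cons, Nat.add_comm u.length, ← add_assoc]

theorem realizes_mainRun (hτ : (A.mcGame ℓ W).IsStrategy p (A.extend ℓ (τ p))) (u : List α)
    (hu : ∀ k < u.length, ℓ k = u[k]?) :
    ∃ h, A.Realizes τ p ℓ (A.mainRun τ u) u.length h := by
  have h0 : A.Realizes τ p ℓ (fun _ => [], A.init) 0 [] := ⟨.refl, rfl⟩
  simpa [mainRun] using h0.run hτ u (by simpa using hu)

/-- A run is realized for `p` as soon as its state and the observations of `p` are those of the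
main run. -/
theorem realizes_of_mainRun (hτ : (A.mcGame ℓ W).IsStrategy p (A.extend ℓ (τ p))) (u : List α)
    (hu : ∀ k < u.length, ℓ k = u[k]?) {x : (Player → List (α × PosForm Q)) × Q}
    (hx1 : x.1 p = (A.mainRun τ u).1 p) (hx2 : x.2 = (A.mainRun τ u).2) :
    ∃ h, A.Realizes τ p ℓ x u.length h := by
  obtain ⟨h, hh⟩ := realizes_mainRun hτ u hu
  refine ⟨h, ?_⟩
  -- `Realizes` ignores the observations of the opponent, which may therefore stem from another
  -- word.
  rw [Realizes, hx1, hx2]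
  exact hh

end

/-! ### Finite words -/

/-- The run is part of a play that follows the winning strategy of `p`. The opponent's observations
in `x` are free, which is what permits mixing two histories. -/
theorem run_mem_acc_iff {p : Player} {u v : List α}
    (hw : (A.finGame (u ++ v)).IsWinning p (A.extend (fun i => (u ++ v)[i]?) (τ p)))
    {x : (Player → List (α × PosForm Q)) × Q}
    (hx1 : x.1 p = (A.mainRun τ u).1 p) (hx2 : x.2 = (A.mainRun τ u).2) :
    (A.run τ x v).2 ∈ A.acc ↔ p = .eve := by
  obtain ⟨hτ, hwin⟩ := hw
  obtain ⟨h, hh⟩ := realizes_of_mainRun hτ u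
    (fun k hk => by simp [List.getElem?_append_left hk]) hx1 hx2
  obtain ⟨h', hh'⟩ := hh.run hτ v (fun k hk => by simp [List.getElem?_append_right])
  obtain ⟨g, t, h0, hg, hgt⟩ := exists_seq_through (exists_stepBy hτ) hh'.1
  have hplay := isPlay_of_legalStep (A.finGame (u ++ v)).eveWins h0 fun k => (hg k).1
  have hπ := hwin _ hplay (agrees_of_stepBy _ h0 hg)
  have ht : (g t).2 = ((u ++ v).length, .state (A.run τ x v).2) := by simp [hgt]
  constructor
  · intro hacc
    cases p with
    | eve => rfl
    | adam => exact absurd ⟨t, _, hacc, ht⟩ hπ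
  · rintro rfl
    obtain ⟨k, q, hq, hk⟩ := hπ
    rwa [state_unique hplay.2 ht hk]

theorem FinGFG.exists_classifier (hA : A.FinGFG) :
    ∃ q : List α → Q,
      ∀ u u', q u = q u' → ∀ v, u ++ v ∈ A.finLanguage → u' ++ v ∈ A.finLanguage := by
  obtain ⟨⟨τE, hE⟩, ⟨τA, hA⟩⟩ := hA
  let τ : Player → List (α × PosForm Q) → PosForm Q := fun p => Player.casesOn p τE τA
  refine ⟨fun u => (A.mainRun τ u).2, fun u u' huu v hv => ?_⟩
  by_contra hv'
  -- Eve remembers `u`, Adam remembers `u'`, and the state is common to both.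
  let x : (Player → List (α × PosForm Q)) × Q :=
    (fun p => Player.casesOn p ((A.mainRun τ u).1 .eve) ((A.mainRun τ u').1 .adam),
      (A.mainRun τ u).2)
  have h1 := run_mem_acc_iff (τ := τ) (p := .eve) (hE _ hv) (x := x) rfl rfl
  have h2 := run_mem_acc_iff (τ := τ) (p := .adam) (hA _ hv') (x := x) rfl huu
  simp [h1] at h2

end AltAutomaton

/-! ### Infinite words -/

/-- The infinite word that begins with `u` and goes on with `x`. -/
def prepend {α : Type*} : List α → (ℕ → α) → ℕ → α
  | [], x => x
  | a :: u, x => fun n => Nat.casesOn n a (prepend u x)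

/-- The first `n` letters of an infinite word. -/
def pref {α : Type*} (x : ℕ → α) (n : ℕ) : List α :=
  (List.range n).map x

section

variable {α : Type*}

theorem prepend_append (u v : List α) (x : ℕ → α) :
    prepend (u ++ v) x = prepend u (prepend v x) := by
  induction u with
  | nil => rfl
  | cons a u ih => simp [prepend, ih]

theorem prepend_length_add (u : List α) (x : ℕ → α) (n : ℕ) :
    prepend u x (u.length + n) = x n := by
  induction u with
  | nil => simp [prepend]
  | cons a u ih =>
    rw [List.length_cons, add_right_comm]
    exact ih

theorem prepend_of_lt (u : List α) (x : ℕ → α) (n : ℕ) (h : n < u.length) :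
    some (prepend u x n) = u[n]? := by
  induction u generalizing n with
  | nil => simp at h
  | cons a u ih =>
    cases n with
    | zero => simp [prepend]
    | succ n => simpa [prepend] using ih n (by simpa using h)

theorem pref_succ (x : ℕ → α) (n : ℕ) : pref x (n + 1) = pref x n ++ [x n] := by
  simp [pref, List.range_succ]

@[simp] theorem length_pref (x : ℕ → α) (n : ℕ) : (pref x n).length = n := by
  simp [pref]

theorem pref_add (x : ℕ → α) (n m : ℕ) :
    pref x (n + m) = pref x n ++ pref (fun k => x (n + k)) m := by
  simp [pref, List.range_add]

theorem pref_prepend (u : List α) (x : ℕ → α) (n : ℕ) :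
    pref (prepend u x) (u.length + n) = u ++ pref x n := by
  rw [pref_add]
  congr 1
  · apply List.ext_getElem?
    intro i
    by_cases hi : i < u.length
    · rw [← prepend_of_lt u x i hi]
      simp [pref, hi]
    · simp [pref, hi]
  · simp [prepend_length_add]

theorem prepend_pref (x : ℕ → α) (n : ℕ) : prepend (pref x n) (fun k => x (n + k)) = x := by
  funext i
  by_cases hi : i < n
  · have := prepend_of_lt (pref x n) (fun k => x (n + k)) i (by simpa using hi)
    simpa [pref, hi] using this
  · have := prepend_length_add (pref x n) (fun k => x (n + k)) (i - n)
    rw [length_pref, Nat.add_sub_cancel' (by omega)] at this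
    exact this

end

/-! ### Büchi acceptance along the joint run -/

namespace AltAutomaton

variable {α Q : Type*} {A : AltAutomaton α Q} {τ : Player → List (α × PosForm Q) → PosForm Q}

open Filter

theorem frequently_run_mem_acc_iff {p : Player} {u : List α} {y : ℕ → α}
    (hw : (A.infGame (prepend u y)).IsWinning p
      (A.extend (fun i => some (prepend u y i)) (τ p)))
    {x : (Player → List (α × PosForm Q)) × Q}
    (hx1 : x.1 p = (A.mainRun τ u).1 p) (hx2 : x.2 = (A.mainRun τ u).2) :
    (∃ᶠ n in atTop, (A.run τ x (pref y n)).2 ∈ A.acc) ↔ p = .eve := by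
  obtain ⟨hτ, hwin⟩ := hw
  obtain ⟨h, hh⟩ := realizes_of_mainRun hτ u (fun k hk => prepend_of_lt u y k hk) hx1 hx2
  have hstep : ∀ n h, A.Realizes τ p (fun i => some (prepend u y i)) (A.run τ x (pref y n))
        (u.length + n) h →
      ∃ h', Relation.TransGen (A.StepBy p (τ p) (fun i => some (prepend u y i)))
          (h, (u.length + n, .state (A.run τ x (pref y n)).2))
          (h', (u.length + (n + 1), .state (A.run τ x (pref y (n + 1))).2)) ∧
        A.Realizes τ p (fun i => some (prepend u y i)) (A.run τ x (pref y (n + 1)))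
          (u.length + (n + 1)) h' := by
    intro n h hr
    rw [pref_succ, run_append_singleton]
    exact hr.stepLetter hτ (by rw [prepend_length_add])
  choose! s hs1 hs2 using hstep
  let H : ℕ → List (ℕ × PosForm Q) := fun n => Nat.rec h s n
  have hH : ∀ n, A.Realizes τ p (fun i => some (prepend u y i)) (A.run τ x (pref y n))
      (u.length + n) (H n) := by
    intro n
    induction n with
    | zero => exact hh
    | succ n ih => exact hs2 n _ ih
  -- One block of moves per letter of `y`; the partial play on `u` is then put in front.
  obtain ⟨f, T, hT, hfT, hf0, hf⟩ := exists_seq_of_forall_transGen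
    (c := fun n => (H n, (u.length + n, PosForm.state (A.run τ x (pref y n)).2)))
    (fun n => hs1 n _ (hH n))
  obtain ⟨g, t, h0, hg, hgf⟩ := exists_seq_of_reflTransGen (hH 0).1 hf0 hf
  have hplay := isPlay_of_legalStep (A.infGame (prepend u y)).eveWins h0 fun k => (hg k).1
  have hπ := hwin _ hplay (agrees_of_stepBy _ h0 hg)
  have hvisit : ∀ n, (g (t + T n)).2 = (u.length + n, .state (A.run τ x (pref y n)).2) := by
    intro n
    rw [hgf, hfT]
  have hiff : (fun n => (g n).2) ∈ (A.infGame (prepend u y)).eveWins ↔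
      ∃ᶠ n in atTop, (A.run τ x (pref y n)).2 ∈ A.acc := by
    change (∃ᶠ k in atTop, ∃ i, ∃ q ∈ A.acc, (g k).2 = (i, PosForm.state q)) ↔ _
    rw [frequently_atTop, frequently_atTop]
    constructor
    · intro hfr N
      obtain ⟨k, hk, i, q, hq, hki⟩ := hfr (t + T N)
      -- The letter counter is monotone, so a late visit happens after at least `u.length + N`
      -- letters, and `state_unique` identifies its state with that of the run.
      have hle : (g (t + T N)).2.1 ≤ (g k).2.1 := fst_monotone hplay.2 hk
      rw [hvisit, hki] at hle
      obtain ⟨n, rfl⟩ := Nat.exists_eq_add_of_le (show u.length ≤ i by simp at hle; omega)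
      refine ⟨n, by simpa using hle, ?_⟩
      rwa [state_unique hplay.2 (hvisit n) hki]
    · intro hfr K
      obtain ⟨n, hn, hacc⟩ := hfr K
      exact ⟨t + T n, by have := hT.id_le n; simp at this; omega, _, _, hacc, hvisit n⟩
  rw [← hiff]
  cases p with
  | eve => exact iff_of_true hπ rfl
  | adam => exact iff_of_false hπ (by simp)

/-- Besides separating residuals, the map follows paths of `A` and decides acceptance along them;
weakness of `A` is exploited through these two properties. -/
theorem InfGFG.exists_classifier (hA : A.InfGFG) :
    ∃ q : List α → Q,
      (∀ u v, Relation.ReflTransGen A.Edge (q u) (q (u ++ v))) ∧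
      (∀ u x, (∃ᶠ n in atTop, q (u ++ pref x n) ∈ A.acc) ↔ prepend u x ∈ A.infLanguage) ∧
      ∀ u u', q u = q u' → ∀ x, prepend u x ∈ A.infLanguage → prepend u' x ∈ A.infLanguage := by
  obtain ⟨⟨τE, hE⟩, ⟨τA, hA⟩⟩ := hA
  let τ : Player → List (α × PosForm Q) → PosForm Q := fun p => Player.casesOn p τE τA
  refine ⟨fun u => (A.mainRun τ u).2, reach_mainRun, fun u x => ?_, fun u u' huu x hx => ?_⟩
  · simp only [mainRun, run_append]
    by_cases hu : prepend u x ∈ A.infLanguage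
    · have := frequently_run_mem_acc_iff (τ := τ) (p := .eve) (hE _ hu)
        (x := A.mainRun τ u) rfl rfl
      exact iff_of_true (this.2 rfl) hu
    · have := frequently_run_mem_acc_iff (τ := τ) (p := .adam) (hA _ hu)
        (x := A.mainRun τ u) rfl rfl
      exact iff_of_false (fun h => by simpa using this.1 h) hu
  · by_contra hx'
    let c : (Player → List (α × PosForm Q)) × Q :=
      (fun p => Player.casesOn p ((A.mainRun τ u).1 .eve) ((A.mainRun τ u').1 .adam),
        (A.mainRun τ u).2)
    have h1 := frequently_run_mem_acc_iff (τ := τ) (p := .eve) (hE _ hx) (x := c) rfl rfl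
    have h2 := frequently_run_mem_acc_iff (τ := τ) (p := .adam) (hA _ hx') (x := c) rfl huu
    simp [h1] at h2

end AltAutomaton

/-! ### The quotient automaton -/

/-- A right congruence that is refined by a map to a finite type `Q` has a deterministic quotient
with at most as many states as `Q` has elements. -/
theorem exists_quotient_transition {α Q X : Type*} [Fintype Q] (q : List α → Q)
    (res : List α → X) (hq : ∀ u u', q u = q u' → res u = res u')
    (hres : ∀ u u' a, res u = res u' → res (u ++ [a]) = res (u' ++ [a])) :
    ∃ (n : ℕ) (cls : List α → Fin n) (d : Fin n → α → Fin n), n ≤ Fintype.card Q ∧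
      (∀ u u', cls u = cls u' ↔ res u = res u') ∧ ∀ u a, d (cls u) a = cls (u ++ [a]) := by
  classical
  have hex : ∀ s : Set.range res, ∃ u, res u = s := fun s => s.2
  choose rep hrep using hex
  -- The values of `q` at one representative per residual are distinct, whence the bound on the
  -- number of states.
  have hinj : Function.Injective fun s : Set.range res => q (rep s) := by
    intro s s' h
    apply Subtype.ext
    rw [← hrep s, ← hrep s']
    exact hq _ _ h
  have : Finite (Set.range res) := Finite.of_injective _ hinj
  have := Fintype.ofFinite (Set.range res)
  let e := Fintype.equivFin (Set.range res)
  refine ⟨Fintype.card (Set.range res), fun u => e ⟨res u, u, rfl⟩,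
    fun i a => e ⟨res (rep (e.symm i) ++ [a]), _, rfl⟩, Fintype.card_le_of_injective _ hinj,
    fun u u' => e.injective.eq_iff.trans Subtype.ext_iff, fun u a => ?_⟩
  have := hres _ u a (hrep ⟨res u, u, rfl⟩)
  simp [this]

theorem cls_append_congr {α : Type*} {n : ℕ} {cls : List α → Fin n} {d : Fin n → α → Fin n}
    (hd : ∀ u a, d (cls u) a = cls (u ++ [a])) {u u' : List α} (h : cls u = cls u')
    (v : List α) : cls (u ++ v) = cls (u' ++ v) := by
  induction v using List.reverseRecOn with
  | nil => simpa using h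
  | append_singleton v a ih => rw [← List.append_assoc, ← List.append_assoc, ← hd, ← hd, ih]

/-! ### The minimal DFA -/

namespace AltAutomaton

variable {α Q : Type*} {A : AltAutomaton α Q}

theorem FinGFG.exists_dfa [Fintype Q] (hA : A.FinGFG) :
    ∃ (Q' : Type) (_ : Fintype Q') (D : DFA α Q'),
      D.accepts = A.finLanguage ∧ Fintype.card Q' ≤ Fintype.card Q := by
  obtain ⟨q, hq⟩ := hA.exists_classifier
  obtain ⟨n, cls, d, hn, hcls, hd⟩ := exists_quotient_transition q
    (fun u => {v | u ++ v ∈ A.finLanguage})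
    (fun u u' h => Set.ext fun v => ⟨hq u u' h v, hq u' u h.symm v⟩)
    (fun u u' a h => Set.ext fun v => by simpa using Set.ext_iff.1 h (a :: v))
  -- Finality does not depend on the representative: it says that the residual contains the empty
  -- word.
  let D : DFA α (Fin n) := ⟨d, cls [], {i | ∃ u ∈ A.finLanguage, cls u = i}⟩
  have heval : ∀ u, D.eval u = cls u := by
    intro u
    induction u using List.reverseRecOn with
    | nil => rfl
    | append_singleton u a ih => rw [DFA.eval_append_singleton, ih]; exact hd u a
  refine ⟨Fin n, inferInstance, D, ?_, by simpa using hn⟩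
  ext u
  rw [DFA.mem_accepts, heval]
  constructor
  · rintro ⟨u', hu', h⟩
    simpa using (Set.ext_iff.1 ((hcls _ _).1 h) []).1 (by simpa using hu')
  · exact fun hu => ⟨u, hu, rfl⟩

open Filter

/-! ### Deterministic automata on infinite words -/

/-- There is exactly one play, so the strategies are irrelevant. -/
theorem mem_infLanguage_of_deterministic {s : List α → Q} (h0 : s [] = A.init)
    (hs : ∀ u a, A.δ (s u) a = .state (s (u ++ [a]))) (w : ℕ → α) :
    w ∈ A.infLanguage ↔ ∃ᶠ n in atTop, s (pref w n) ∈ A.acc := by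
  have huniq : ∀ π, (A.infGame w).IsPlay π → ∀ k, π k = (k, .state (s (pref w k))) := by
    intro π hπ k
    induction k with
    | zero => rw [hπ.1]; simp [pref, h0, infGame, mcGame]
    | succ k ih =>
      have := hπ.2 k
      rw [ih] at this
      rw [show π (k + 1) = A.next _ k _ from this]
      simp [next, hs, pref_succ]
  have hwin : ∀ π, (A.infGame w).IsPlay π →
      (π ∈ (A.infGame w).eveWins ↔ ∃ᶠ n in atTop, s (pref w n) ∈ A.acc) := by
    intro π hπ
    change (∃ᶠ k in atTop, ∃ i, ∃ q ∈ A.acc, π k = (i, PosForm.state q)) ↔ _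
    simp [huniq π hπ]
  let π₀ : ℕ → ℕ × PosForm Q := fun k => (k, .state (s (pref w k)))
  have hplay : (A.infGame w).IsPlay π₀ := by
    refine ⟨by simp [π₀, pref, h0, infGame, mcGame], fun k => ?_⟩
    change _ = A.next _ k _
    simp [π₀, next, hs, pref_succ]
  constructor
  · rintro ⟨σ, hσ, hσw⟩
    refine (hwin π₀ hplay).1 (hσw π₀ hplay fun k hk => ?_)
    have h1 := hplay.2 k
    have h2 := hσ π₀ hplay k hk
    exact Eq.trans h1 (Eq.symm h2)
  · intro h
    refine ⟨fun _ v => π₀ (v.1 + 1), fun π hπ k _ => ?_, fun π hπ _ => (hwin π hπ).2 h⟩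
    rw [huniq π hπ]
    exact hplay.2 k

/-! ### Weak automata -/

/-- The word `x`, read after `u`, never leaves the strongly connected component of `cls u`. -/
def Recurrent {S : Type*} (cls : List α → S) (u : List α) (x : ℕ → α) : Prop :=
  ∀ n, ∃ m ≥ n, ∃ v, cls (u ++ pref x m ++ v) = cls u

theorem Recurrent.congr {n : ℕ} {cls : List α → Fin n} {d : Fin n → α → Fin n}
    (hd : ∀ u a, d (cls u) a = cls (u ++ [a])) {u u' : List α} (h : cls u = cls u')
    {x : ℕ → α} (hx : Recurrent cls u x) : Recurrent cls u' x := by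
  intro k
  obtain ⟨m, hm, v, hv⟩ := hx k
  refine ⟨m, hm, v, ?_⟩
  rw [← h, ← hv, List.append_assoc, List.append_assoc, cls_append_congr hd h]

/-- In a weak automaton, accepted and rejected words do not stay in the same strongly connected
component of the quotient. -/
theorem IsWeak.not_recurrent_and_recurrent [Finite Q] (hweak : A.IsWeak) {q : List α → Q}
    (hreach : ∀ u v, Relation.ReflTransGen A.Edge (q u) (q (u ++ v)))
    (hacc : ∀ u x, (∃ᶠ n in atTop, q (u ++ pref x n) ∈ A.acc) ↔ prepend u x ∈ A.infLanguage)
    {n : ℕ} {cls : List α → Fin n} {d : Fin n → α → Fin n}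
    (hd : ∀ u a, d (cls u) a = cls (u ++ [a]))
    (hcls : ∀ u u', cls u = cls u' → ∀ x, prepend u x ∈ A.infLanguage →
      prepend u' x ∈ A.infLanguage)
    {u : List α} {x y : ℕ → α} (hx : prepend u x ∈ A.infLanguage) (hxr : Recurrent cls u x)
    (hy : prepend u y ∉ A.infLanguage) (hyr : Recurrent cls u y) : False := by
  -- After `q` has met `S` along `z`, recurrence supplies a word leading back to the class of `u`.
  have hvisit : ∀ (S : Set Q) (z : ℕ → α) (u' : List α), cls u' = cls u → Recurrent cls u z →
      (∃ n, q (u' ++ pref z n) ∈ S) → ∃ v, cls (u' ++ v) = cls u ∧ ∃ s ∈ S,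
        Relation.ReflTransGen A.Edge (q u') s ∧ Relation.ReflTransGen A.Edge s (q (u' ++ v)) := by
    rintro S z u' hu' hz ⟨n, hn⟩
    obtain ⟨m, hm, v, hv⟩ := hz.congr hd hu'.symm n
    obtain ⟨k, rfl⟩ := Nat.exists_eq_add_of_le hm
    refine ⟨pref z (n + k) ++ v, by rw [← List.append_assoc, hv, hu'], _, hn, hreach _ _, ?_⟩
    rw [pref_add, List.append_assoc, ← List.append_assoc u']
    exact hreach _ _
  -- A round follows `x` up to an accepting state and returns, then follows `y` up to a rejecting
  -- state and returns. Both words keep their status because the class is restored.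
  have hround : ∀ u', cls u' = cls u → ∃ v, cls (u' ++ v) = cls u ∧
      (∃ s ∈ A.acc, Relation.ReflTransGen A.Edge (q u') s ∧
        Relation.ReflTransGen A.Edge s (q (u' ++ v))) ∧
      ∃ s ∉ A.acc, Relation.ReflTransGen A.Edge (q u') s ∧
        Relation.ReflTransGen A.Edge s (q (u' ++ v)) := by
    intro u' hu'
    obtain ⟨v, hv, s, hs, h1, h2⟩ := hvisit A.acc x u' hu' hxr
      ((hacc u' x).2 (hcls _ _ hu'.symm x hx)).exists
    have hy' : ¬∃ᶠ n in atTop, q (u' ++ v ++ pref y n) ∈ A.acc := fun h =>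
      hy (hcls _ _ hv y ((hacc _ y).1 h))
    obtain ⟨v', hv', s', hs', h1', h2'⟩ := hvisit A.accᶜ y (u' ++ v) hv hyr
      (not_frequently.1 hy').exists
    rw [List.append_assoc] at hv' h2'
    refine ⟨v ++ v', hv', ⟨s, hs, h1, h2.trans ?_⟩, s', hs', (hreach _ _).trans h1', h2'⟩
    rw [← List.append_assoc]
    exact hreach _ _
  choose! V hV hVacc hVrej using hround
  let U : ℕ → List α := fun k => (fun u' => u' ++ V u')^[k] u
  have hU : ∀ k, cls (U k) = cls u := by
    intro k
    induction k with
    | zero => rfl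
    | succ k ih =>
      simp only [U, Function.iterate_succ_apply']
      exact hV _ ih
  have hUsucc : ∀ k, U (k + 1) = U k ++ V (U k) := fun k => by
    simp only [U, Function.iterate_succ_apply']
  have hUreach : ∀ k m, Relation.ReflTransGen A.Edge (q (U k)) (q (U (k + m))) := by
    intro k m
    induction m with
    | zero => exact .refl
    | succ m ih =>
      rw [← add_assoc, hUsucc]
      exact ih.trans (hreach _ _)
  -- Two rounds begin in the same state of `A`, so all states met in round `i` lie in one strongly
  -- connected component.
  obtain ⟨i, j, hij, heq⟩ : ∃ i j, i < j ∧ q (U i) = q (U j) := by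
    obtain ⟨i, j, hne, heq⟩ := Finite.exists_ne_map_eq_of_infinite fun k => q (U k)
    rcases hne.lt_or_gt with h | h
    · exact ⟨i, j, h, heq⟩
    · exact ⟨j, i, h, heq.symm⟩
  obtain ⟨m, rfl⟩ := Nat.exists_eq_add_of_lt hij
  have hback : Relation.ReflTransGen A.Edge (q (U i ++ V (U i))) (q (U i)) := by
    rw [← hUsucc, heq, add_right_comm]
    exact hUreach _ _
  obtain ⟨s, hs, h1, h2⟩ := hVacc _ (hU i)
  obtain ⟨s', hs', h1', h2'⟩ := hVrej _ (hU i)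
  exact hs' ((hweak _ _ h1' (h2'.trans hback)).1 ((hweak _ _ h1 (h2.trans hback)).2 hs))

theorem InfGFG.exists_dww [Fintype Q] (hA : A.InfGFG) (hweak : A.IsWeak) :
    ∃ (Q' : Type) (_ : Fintype Q') (D : AltAutomaton α Q'),
      D.IsDeterministic ∧ D.IsWeak ∧ D.infLanguage = A.infLanguage ∧
        Fintype.card Q' ≤ Fintype.card Q := by
  obtain ⟨q, hreach, hacc, hq⟩ := hA.exists_classifier
  obtain ⟨n, cls, d, hn, hcls, hd⟩ := exists_quotient_transition q
    (fun u => {x | prepend u x ∈ A.infLanguage})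
    (fun u u' h => Set.ext fun v => ⟨hq u u' h v, hq u' u h.symm v⟩)
    (fun u u' a h => Set.ext fun x => by
      simpa [prepend_append] using Set.ext_iff.1 h (prepend [a] x))
  have hcls' : ∀ u u', cls u = cls u' → ∀ x, prepend u x ∈ A.infLanguage →
      prepend u' x ∈ A.infLanguage := fun u u' h x => (Set.ext_iff.1 ((hcls u u').1 h) x).1
  let D : AltAutomaton α (Fin n) :=
    { init := cls []
      δ := fun i a => .state (d i a)
      -- A class on no cycle has no recurrent word and is rejecting.
      acc := {i | ∃ u x, cls u = i ∧ prepend u x ∈ A.infLanguage ∧ Recurrent cls u x} }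
  have hpath : ∀ {i j}, Relation.ReflTransGen D.Edge i j → ∀ u, cls u = i →
      ∃ v, cls (u ++ v) = j := by
    intro i j hij u hu
    induction hij with
    | refl => exact ⟨[], by simpa using hu⟩
    | tail _ he ih =>
      obtain ⟨v, hv⟩ := ih
      obtain ⟨a, ha⟩ := he
      refine ⟨v ++ [a], ?_⟩
      rw [← List.append_assoc, ← hd, hv]
      exact (Set.mem_singleton_iff.1 ha).symm
  have haccD : ∀ i j, Relation.ReflTransGen D.Edge i j → Relation.ReflTransGen D.Edge j i →
      i ∈ D.acc → j ∈ D.acc := by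
    rintro i j hij hji ⟨u, x, hu, hx, hxr⟩
    obtain ⟨v, hv⟩ := hpath hij u hu
    obtain ⟨v', hv'⟩ := hpath hji _ hv
    have hloop : cls u = cls (u ++ v ++ v') := hu.trans hv'.symm
    -- From `j`, go back to `i` by `v'` and follow the recurrent word of `i` from there.
    refine ⟨u ++ v, prepend v' x, hv, ?_, fun k => ?_⟩
    · rw [← prepend_append]
      exact hcls' _ _ hloop x hx
    · obtain ⟨m, hm, z, hz⟩ := hxr.congr hd hloop k
      refine ⟨v'.length + m, by omega, z ++ v, ?_⟩
      rw [pref_prepend, ← List.append_assoc, ← List.append_assoc]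
      exact cls_append_congr hd (hz.trans hloop.symm) v
  refine ⟨Fin n, inferInstance, D, fun i a => ⟨_, rfl⟩,
    fun i j hij hji => ⟨haccD i j hij hji, haccD j i hji hij⟩, ?_, by simpa using hn⟩
  ext w
  rw [mem_infLanguage_of_deterministic (A := D) (s := cls) rfl
    (fun u a => congrArg PosForm.state (hd u a))]
  -- There are finitely many classes, so from some time on only those visited infinitely often
  -- occur.
  have hrec : ∀ᶠ k in atTop, Recurrent cls (pref w k) (fun i => w (k + i)) := by
    have : ∀ᶠ k in atTop, ∀ i, (∃ᶠ m in atTop, cls (pref w m) = i) ∨ cls (pref w k) ≠ i := by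
      rw [eventually_all]
      intro i
      by_cases hi : ∃ᶠ m in atTop, cls (pref w m) = i
      · exact Eventually.of_forall fun _ => Or.inl hi
      · exact (not_frequently.1 hi).mono fun _ h => Or.inr h
    refine this.mono fun k hk N => ?_
    obtain ⟨m, hm, heq⟩ := frequently_atTop.1 ((hk _).resolve_right (not_not.2 rfl)) (k + N)
    obtain ⟨l, rfl⟩ := Nat.exists_eq_add_of_le (show k ≤ m by omega)
    refine ⟨l, by omega, [], ?_⟩
    rw [List.append_nil, ← pref_add, heq]
  constructor
  · intro h
    obtain ⟨k, ⟨u, x, hu, hx, hxr⟩, hk⟩ := (h.and_eventually hrec).exists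
    -- Otherwise `x` and the tail of `w` are an accepted and a rejected word recurrent at the same
    -- class.
    by_contra hw
    refine hweak.not_recurrent_and_recurrent hreach hacc hd hcls' (hcls' _ _ hu x hx)
      (hxr.congr hd hu) ?_ hk
    rwa [prepend_pref]
  · intro hw
    -- The tail of `w` itself witnesses that every late class is accepting.
    refine (hrec.mono fun k hk => ?_).frequently
    exact ⟨_, _, rfl, by rwa [prepend_pref], hk⟩

end AltAutomaton

theorem mainTheorem4 {α Q : Type*} [Finite α] [Nonempty α] [Fintype Q] (A : AltAutomaton α Q) :
    (A.FinGFG →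
      ∃ (Q' : Type) (_ : Fintype Q') (D : DFA α Q'),
        D.accepts = A.finLanguage ∧ Fintype.card Q' ≤ Fintype.card Q) ∧
    (A.IsWeak → A.InfGFG →
      ∃ (Q' : Type) (_ : Fintype Q') (D : AltAutomaton α Q'),
        D.IsDeterministic ∧ D.IsWeak ∧ D.infLanguage = A.infLanguage ∧
          Fintype.card Q' ≤ Fintype.card Q) :=
  ⟨fun h => h.exists_dfa, fun hw h => h.exists_dww hw⟩
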